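/- Let $k$ be a field of arbitrary characteristic, and let $f \in k[x_1,x_2,x_3,x_4]$ be homogeneous of degree $3$. Let $\mathcal{S} \subset \mathcal{O}^{\oplus 4}$ be the tautological subbundle on the Grassmannian $\operatorname{Gr}(4,2)$ of $2$-dimensional subspaces of $k^{\oplus 4}$, let $\mathcal{E} = \operatorname{Sym}^3(\mathcal{S}^{\vee})$, and let $\sigma_f$ be the section of $\mathcal{E}$ whose value at $S$ is the restriction $f|S$. A line with coefficients in an extension field $L$ of $k$ is an $L$-point of $\operatorname{Gr}(4,2)$, i.e. a $2$-dimensional subspace $S \subset L^{\oplus 4}$; for example, every closed point of $\operatorname{Gr}(4,2)$ gives such an $S$, with $L$ its residue field. A zero $S$ of $\sigma_f$ is called simple if the differential $$ d\sigma_f \colon T_S \operatorname{Gr}(4,2) = \operatorname{Hom}_L(S, L^{\oplus 4}/S) \longrightarrow \operatorname{Sym}^3(S^{\vee}) $$ of $\sigma_f$ at $S$ is an isomorphism (equivalently, the Jacobian determinant of $\sigma_f$ at $S$ is nonzero). (1) If the cubic surface $\{f=0\} \subset \mathbf{P}^3_k$ is smooth over $k$, then $\sigma_f$ has only simple zeros: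 for every field extension $L/k$, every $L$-point $S$ of $\operatorname{Gr}(4,2)$ with $\sigma_f(S)=0$ is a simple zero of $\sigma_f$. (2) More generally, let $L/k$ be a field extension and let $S \subset L^{\oplus 4}$ be a $2$-dimensional subspace such that the corresponding line in $\mathbf{P}^3_L$ is contained in the (possibly singular) surface $\{f=0\}$ and the surface is smooth along the line, i.e. no point of the line over an algebraic closure of $L$ is a singular point of the surface. Then $S$ is a simple zero of $\sigma_f$. -/

import Mathlib

open MvPolynomial Module

/-- `Gr(4, 2)(A)`, the `A`-points of the Grassmannian of lines in projective 3-space, for a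
commutative ring `A`: the submodules `S` of `A^4` whose quotient `A^4 / S` is locally free of
rank `2` (equivalently, the rank `2` subbundles of the trivial bundle of rank `4`).
Over a field these are the 2-dimensional subspaces of `A^4`. -/
abbrev Gr42 (A : Type*) [CommRing A] : Type _ := Grassmannian A (Fin 4 → A) 2

namespace CubicLines

section Bundle

variable {k : Type*} [Field k] {A : Type*} [CommRing A] [Algebra k A]

/-- The restriction to `S ⊆ A^4` of the `i`-th coordinate function `x_i`, as an element of `S^∨`. -/
noncomputable def coord (S : Gr42 A) (i : Fin 4) : Dual A S.toSubmodule :=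
  (LinearMap.proj i) ∘ₗ S.toSubmodule.subtype

/-- The value at the point `S` of the bundle `E = Sym³(S^∨)` on `Gr(4, 2)`: the degree 3 part
of the symmetric algebra of the dual of `S`. -/
noncomputable abbrev E (S : Gr42 A) : Submodule A (SymmetricAlgebra A (Dual A S.toSubmodule)) :=
  LinearMap.range (SymmetricAlgebra.ι A (Dual A S.toSubmodule)) ^ 3

/-- The restriction `f|S` of a polynomial `f ∈ k[x_1, …, x_4] = Sym((k^4)^∨)` to `S`: its image
under the homomorphism of symmetric algebras induced by `S ⊆ A^4`. -/
noncomputable def restrict (f : MvPolynomial (Fin 4) k) (S : Gr42 A) :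
    SymmetricAlgebra A (Dual A S.toSubmodule) :=
  eval₂ ((algebraMap A _).comp (algebraMap k A)) (fun i => SymmetricAlgebra.ι A _ (coord S i)) f

theorem restrict_mem {f : MvPolynomial (Fin 4) k} (hf : f.IsHomogeneous 3) (S : Gr42 A) :
    restrict f S ∈ E S := by
  rw [restrict, eval₂_eq]
  refine Submodule.sum_mem _ fun d hd => ?_
  rw [RingHom.comp_apply, ← Algebra.smul_def]
  refine Submodule.smul_mem _ _ ?_
  have hdeg : ∑ i, d i = 3 := by
    have h := hf (mem_support_iff.mp hd)
    rw [Finsupp.weight_apply, Finsupp.sum_fintype _ _ (by simp)] at h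
    simpa using h
  have key : ∀ s : Finset (Fin 4),
      ∏ i ∈ s, (SymmetricAlgebra.ι A (Dual A S.toSubmodule) (coord S i)) ^ d i ∈
        LinearMap.range (SymmetricAlgebra.ι A (Dual A S.toSubmodule)) ^ (∑ i ∈ s, d i) := by
    intro s
    induction s using Finset.cons_induction with
    | empty => simp [Submodule.one_le.mp le_rfl]
    | cons a s ha ih =>
      rw [Finset.prod_cons, Finset.sum_cons, pow_add]
      exact Submodule.mul_mem_mul (Submodule.pow_mem_pow _ (LinearMap.mem_range_self _ _) _) ih
  have h := key Finset.univ
  rw [hdeg] at h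
  have hsub : ∏ i ∈ d.support, (SymmetricAlgebra.ι A (Dual A S.toSubmodule) (coord S i)) ^ d i =
      ∏ i, (SymmetricAlgebra.ι A (Dual A S.toSubmodule) (coord S i)) ^ d i :=
    Finset.prod_subset (Finset.subset_univ _) (by intro i _ hi; simp at hi; simp [hi])
  rw [hsub]
  exact h

/-- The section `σ_f` of `E = Sym³(S^∨)` on `Gr(4, 2)` defined by a cubic form `f`; its value at
the point `S` is `f|S`. -/
noncomputable def sigma (f : MvPolynomial (Fin 4) k) (hf : f.IsHomogeneous 3) (S : Gr42 A) : E S :=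
  ⟨restrict f S, restrict_mem hf S⟩

end Bundle

section Tangent

open DualNumber TrivSqZeroExt

variable {L : Type*} [Field L]

/-- The submodule `{u₀ + ε u₁ : u₀ ∈ S, u₁ mod S = θ(u₀)}` of `L[ε]^4` attached to a linear map
`θ : S → L^4 / S`. -/
def deformationSubmodule (S : Submodule L (Fin 4 → L)) (θ : S →ₗ[L] (Fin 4 → L) ⧸ S) :
    Submodule L[ε] (Fin 4 → L[ε]) where
  carrier := {u | ∃ h : (fun i => (u i).fst) ∈ S, S.mkQ (fun i => (u i).snd) = θ ⟨_, h⟩}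
  zero_mem' := ⟨S.zero_mem, by
    have : θ ⟨fun i => ((0 : Fin 4 → L[ε]) i).fst, S.zero_mem⟩ = 0 := θ.map_zero
    rw [this]; exact map_zero _⟩
  add_mem' := by
    rintro u v ⟨hu, hu'⟩ ⟨hv, hv'⟩
    refine ⟨S.add_mem hu hv, ?_⟩
    have h1 : (⟨fun i => ((u + v) i).fst, S.add_mem hu hv⟩ : S) = ⟨_, hu⟩ + ⟨_, hv⟩ := rfl
    rw [h1, map_add, ← hu', ← hv', ← map_add]; rfl
  smul_mem' := by
    rintro c u ⟨hu, hu'⟩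
    have h0 : (fun i => ((c • u) i).fst) = c.fst • fun i => (u i).fst := rfl
    refine ⟨h0 ▸ S.smul_mem _ hu, ?_⟩
    have h1 : (⟨fun i => ((c • u) i).fst, h0 ▸ S.smul_mem _ hu⟩ : S) = c.fst • ⟨_, hu⟩ := rfl
    have h2 : (fun i => ((c • u) i).snd) =
        c.fst • (fun i => (u i).snd) + c.snd • fun i => (u i).fst := by
      funext i; simp [mul_comm]
    have h3 : S.mkQ (fun i => (u i).fst) = 0 := (Submodule.Quotient.mk_eq_zero S).2 hu
    rw [h1, map_smul, ← hu', h2, map_add, map_smul, map_smul, h3, smul_zero, add_zero]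

theorem mem_deformationSubmodule {S : Submodule L (Fin 4 → L)}
    {θ : S →ₗ[L] (Fin 4 → L) ⧸ S} {u : Fin 4 → L[ε]} :
    u ∈ deformationSubmodule S θ ↔
      ∃ h : (fun i => (u i).fst) ∈ S, S.mkQ (fun i => (u i).snd) = θ ⟨_, h⟩ := Iff.rfl

theorem exists_quotEquiv (S : Gr42 L) (θ : S.toSubmodule →ₗ[L] (Fin 4 → L) ⧸ S.toSubmodule) :
    Nonempty (((Fin 4 → L[ε]) ⧸ deformationSubmodule S.toSubmodule θ) ≃ₗ[L[ε]] (Fin 2 → L[ε])) := by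
  have hr : finrank L ((Fin 4 → L) ⧸ S.toSubmodule) = 2 := by
    have h := S.rankAtStalk_eq ⊥
    rwa [rankAtStalk_eq_finrank_of_free] at h
  let b : ((Fin 4 → L) ⧸ S.toSubmodule) ≃ₗ[L] (Fin 2 → L) :=
    LinearEquiv.ofFinrankEq _ _ (by simp [hr])
  obtain ⟨θ', hθ'⟩ := θ.exists_extend
  let Φ : (Fin 4 → L[ε]) →ₗ[L[ε]] (Fin 2 → L[ε]) :=
    { toFun := fun u j => inl (b (S.toSubmodule.mkQ fun i => (u i).fst) j) +
        inr (b (S.toSubmodule.mkQ (fun i => (u i).snd) - θ' fun i => (u i).fst) j)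
      map_add' := by
        intro u v
        have h1 : (fun i => ((u + v) i).fst) = (fun i => (u i).fst) + fun i => (v i).fst := rfl
        have h2 : (fun i => ((u + v) i).snd) = (fun i => (u i).snd) + fun i => (v i).snd := rfl
        funext j
        rw [h1, h2]
        ext
        · simp
        · simp; ring
      map_smul' := by
        intro c u
        have h1 : (fun i => ((c • u) i).fst) = c.fst • fun i => (u i).fst := rfl
        have h2 : (fun i => ((c • u) i).snd) =
            c.fst • (fun i => (u i).snd) + c.snd • fun i => (u i).fst := by
          funext i; simp [mul_comm]
        funext j
        rw [h1, h2]
        simp only [map_add, map_smul, map_sub]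
        ext
        · simp
        · simp; ring }
  have hker : LinearMap.ker Φ = deformationSubmodule S.toSubmodule θ := by
    ext u
    have hb : Φ u = 0 ↔ b (S.toSubmodule.mkQ fun i => (u i).fst) = 0 ∧
        b (S.toSubmodule.mkQ (fun i => (u i).snd) - θ' fun i => (u i).fst) = 0 := by
      constructor
      · intro h
        refine ⟨funext fun j => ?_, funext fun j => ?_⟩
        · have := congrArg TrivSqZeroExt.fst (congrFun h j)
          simpa [Φ] using this
        · have := congrArg TrivSqZeroExt.snd (congrFun h j)
          simpa [Φ] using this
      · rintro ⟨h1, h2⟩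
        funext j
        change inl (b _ j) + inr (b _ j) = _
        rw [h1, h2]; simp
    rw [LinearMap.mem_ker, hb, mem_deformationSubmodule, LinearEquiv.map_eq_zero_iff,
      LinearEquiv.map_eq_zero_iff, sub_eq_zero]
    constructor
    · rintro ⟨h1, h2⟩
      have h1' := (Submodule.Quotient.mk_eq_zero S.toSubmodule).1 h1
      exact ⟨h1', h2.trans (LinearMap.congr_fun hθ' ⟨_, h1'⟩)⟩
    · rintro ⟨h1, h2⟩
      exact ⟨(Submodule.Quotient.mk_eq_zero S.toSubmodule).2 h1,
        h2.trans (LinearMap.congr_fun hθ' ⟨_, h1⟩).symm⟩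
  have hsurj : Function.Surjective Φ := by
    intro y
    obtain ⟨u0, hu0⟩ := S.toSubmodule.mkQ_surjective (b.symm fun j => (y j).fst)
    obtain ⟨u1, hu1⟩ := S.toSubmodule.mkQ_surjective (b.symm (fun j => (y j).snd) + θ' u0)
    refine ⟨fun i => inl (u0 i) + inr (u1 i), funext fun j => ?_⟩
    have e0 : (fun i => (inl (u0 i) + inr (u1 i) : L[ε]).fst) = u0 := by funext i; simp
    have e1 : (fun i => (inl (u0 i) + inr (u1 i) : L[ε]).snd) = u1 := by funext i; simp
    change inl (b (S.toSubmodule.mkQ fun i => (inl (u0 i) + inr (u1 i) : L[ε]).fst) j) +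
      inr (b (S.toSubmodule.mkQ (fun i => (inl (u0 i) + inr (u1 i) : L[ε]).snd) -
        θ' fun i => (inl (u0 i) + inr (u1 i) : L[ε]).fst) j) = _
    rw [e0, e1, hu0, hu1]
    ext <;> simp
  exact ⟨(Submodule.quotEquivOfEq _ _ hker.symm).trans (Φ.quotKerEquivOfSurjective hsurj)⟩

/-- The first-order deformation of `S ∈ Gr(4, 2)(L)`, a point of `Gr(4, 2)(L[ε])` over `S`,
attached to `θ ∈ Hom(S, L^4 / S)`.  -/
def deformation (S : Gr42 L) (θ : S.toSubmodule →ₗ[L] (Fin 4 → L) ⧸ S.toSubmodule) :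
    Gr42 L[ε] where
  toSubmodule := deformationSubmodule S.toSubmodule θ
  finite_quotient := Module.Finite.equiv (exists_quotEquiv S θ).some.symm
  projective_quotient := Module.Projective.of_equiv (exists_quotEquiv S θ).some.symm
  rankAtStalk_eq p := by
    rw [rankAtStalk_eq_of_equiv (exists_quotEquiv S θ).some, rankAtStalk_eq_finrank_of_free]
    simp

/-- The lift of `s ∈ S` to the point `s + ε w` of the deformation, where `w` represents `θ(s)`. -/
noncomputable def liftVec (S : Gr42 L) (θ : S.toSubmodule →ₗ[L] (Fin 4 → L) ⧸ S.toSubmodule)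
    (s : S.toSubmodule) : (deformation S θ).toSubmodule :=
  ⟨fun i => inl (s.1 i) + inr ((θ s).out i), by
    have e0 : (fun i => (inl (s.1 i) + inr ((θ s).out i) : L[ε]).fst) = s.1 := by funext i; simp
    have e1 : (fun i => (inl (s.1 i) + inr ((θ s).out i) : L[ε]).snd) = (θ s).out := by
      funext i; simp
    refine mem_deformationSubmodule.2 ⟨by rw [e0]; exact s.2, ?_⟩
    have e2 : (⟨fun i => (inl (s.1 i) + inr ((θ s).out i) : L[ε]).fst,
      by rw [e0]; exact s.2⟩ : S.toSubmodule) = s := Subtype.ext e0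
    rw [e1, e2]
    exact Quotient.out_eq _⟩

@[simp] theorem liftVec_fst (S : Gr42 L) (θ : S.toSubmodule →ₗ[L] (Fin 4 → L) ⧸ S.toSubmodule)
    (s : S.toSubmodule) (i : Fin 4) : ((liftVec S θ s).1 i).fst = s.1 i := by
  simp [liftVec]

theorem fst_dual_eq {S : Gr42 L} {θ : S.toSubmodule →ₗ[L] (Fin 4 → L) ⧸ S.toSubmodule}
    (φ : Dual L[ε] (deformation S θ).toSubmodule) (u v : (deformation S θ).toSubmodule)
    (h : ∀ i, (u.1 i).fst = (v.1 i).fst) : (φ u).fst = (φ v).fst := by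
  rw [← sub_eq_zero, ← fst_sub, ← map_sub]
  obtain ⟨h1, h2⟩ := mem_deformationSubmodule.1 (u - v).2
  have h0 : ∀ i, ((u - v).1 i).fst = 0 := fun i => by simp [h i]
  have h3 : (⟨fun i => ((u - v).1 i).fst, h1⟩ : S.toSubmodule) = 0 := Subtype.ext (funext h0)
  rw [h3, map_zero] at h2
  have h4 := (Submodule.Quotient.mk_eq_zero S.toSubmodule).1 h2
  have h5 : u - v = (ε : L[ε]) • liftVec S θ ⟨_, h4⟩ := by
    refine Subtype.ext (funext fun i => ?_)
    change (u - v).1 i = ε * (liftVec S θ ⟨_, h4⟩).1 i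
    ext
    · rw [h0]; simp
    · simp
  rw [h5, map_smul]
  simp

/-- Reduction modulo `ε` of linear forms on a deformation `S̃` of `S`: the form `φ` on `S̃` goes to
the form on `S = S̃ / ε S̃` that it induces. -/
noncomputable def redDual (S : Gr42 L) (θ : S.toSubmodule →ₗ[L] (Fin 4 → L) ⧸ S.toSubmodule) :
    Dual L[ε] (deformation S θ).toSubmodule →ₛₗ[(fstHom L L L).toRingHom] Dual L S.toSubmodule where
  toFun φ :=
    { toFun := fun s => (φ (liftVec S θ s)).fst
      map_add' := fun s t => by
        rw [← fst_add, ← map_add]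
        exact fst_dual_eq φ _ _ fun i => by simp
      map_smul' := fun c s => by
        have : (φ ((inl c : L[ε]) • liftVec S θ s)).fst = c * (φ (liftVec S θ s)).fst := by
          rw [map_smul]; simp
        rw [RingHom.id_apply, smul_eq_mul, ← this]
        exact fst_dual_eq φ _ _ fun i => by simp }
  map_add' φ ψ := rfl
  map_smul' c φ := LinearMap.ext fun s => by simp

theorem redDual_apply (S : Gr42 L) (θ : S.toSubmodule →ₗ[L] (Fin 4 → L) ⧸ S.toSubmodule)
    (φ : Dual L[ε] (deformation S θ).toSubmodule) (u : (deformation S θ).toSubmodule)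
    (s : S.toSubmodule) (h : ∀ i, (u.1 i).fst = s.1 i) : redDual S θ φ s = (φ u).fst :=
  fst_dual_eq φ _ _ fun i => by simp [h i]

/-- The ring homomorphism `Sym(S̃^∨) → Sym(S^∨)`, reduction modulo `ε`, for a deformation `S̃`
of `S`. -/
noncomputable def redSym (S : Gr42 L) (θ : S.toSubmodule →ₗ[L] (Fin 4 → L) ⧸ S.toSubmodule) :
    SymmetricAlgebra L[ε] (Dual L[ε] (deformation S θ).toSubmodule) →+*
      SymmetricAlgebra L (Dual L S.toSubmodule) :=
  letI : Algebra L[ε] (SymmetricAlgebra L (Dual L S.toSubmodule)) :=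
    ((algebraMap L _).comp (fstHom L L L).toRingHom).toAlgebra
  (SymmetricAlgebra.lift
    { toFun := fun φ => SymmetricAlgebra.ι L _ (redDual S θ φ)
      map_add' := fun φ ψ => by rw [map_add, map_add]
      map_smul' := fun c φ => by
        rw [LinearMap.map_smulₛₗ, map_smul, RingHom.id_apply, Algebra.smul_def, Algebra.smul_def]
        rfl } :
    SymmetricAlgebra L[ε] (Dual L[ε] (deformation S θ).toSubmodule) →ₐ[L[ε]] _).toRingHom

@[simp] theorem redSym_ι (S : Gr42 L) (θ : S.toSubmodule →ₗ[L] (Fin 4 → L) ⧸ S.toSubmodule)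
    (φ : Dual L[ε] (deformation S θ).toSubmodule) :
    redSym S θ (SymmetricAlgebra.ι L[ε] _ φ) = SymmetricAlgebra.ι L _ (redDual S θ φ) :=
  letI : Algebra L[ε] (SymmetricAlgebra L (Dual L S.toSubmodule)) :=
    ((algebraMap L _).comp (fstHom L L L).toRingHom).toAlgebra
  SymmetricAlgebra.lift_ι_apply _ _

@[simp] theorem redSym_algebraMap (S : Gr42 L)
    (θ : S.toSubmodule →ₗ[L] (Fin 4 → L) ⧸ S.toSubmodule) (c : L[ε]) :
    redSym S θ (algebraMap L[ε] _ c) = algebraMap L _ c.fst :=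
  letI : Algebra L[ε] (SymmetricAlgebra L (Dual L S.toSubmodule)) :=
    ((algebraMap L _).comp (fstHom L L L).toRingHom).toAlgebra
  AlgHom.commutes _ _

variable {k : Type*} [Field k] [Algebra k L]

/-- The values of `σ_f` are compatible with reduction modulo `ε`. -/
theorem redSym_restrict (f : MvPolynomial (Fin 4) k) (S : Gr42 L)
    (θ : S.toSubmodule →ₗ[L] (Fin 4 → L) ⧸ S.toSubmodule) :
    redSym S θ (restrict f (deformation S θ)) = restrict f S := by
  have hc : ∀ i, redDual S θ (coord (deformation S θ) i) = coord S i := fun i =>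
    LinearMap.ext fun s => by
      rw [redDual_apply S θ _ (liftVec S θ s) s (by simp)]
      simp [coord]
  rw [restrict, restrict, ← coe_eval₂Hom, ← coe_eval₂Hom, ← RingHom.comp_apply]
  congr 1
  refine MvPolynomial.ringHom_ext (fun r => ?_) fun i => ?_
  · simp [TrivSqZeroExt.algebraMap_eq_inl']
  · simpa using congrArg _ (hc i)

/-- Every point of `Gr(4, 2)(L[ε])` lying over `S` is a unique `deformation S θ`: so the tangent
space of `Gr(4, 2)` at `S` is `Hom(S, L^4 / S)`. -/
theorem existsUnique_deformation (S : Gr42 L) (T : Gr42 L[ε])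
    (hT : (fun u i => (u i).fst) '' (T.toSubmodule : Set (Fin 4 → L[ε])) = (S.toSubmodule : Set _)) :
    ∃! θ : S.toSubmodule →ₗ[L] (Fin 4 → L) ⧸ S.toSubmodule, T = deformation S θ := by
  have hmem : ∀ u ∈ T.toSubmodule, (fun i => (u i).fst) ∈ S.toSubmodule := fun u hu => by
    have h : (fun i => (u i).fst) ∈ (S.toSubmodule : Set (Fin 4 → L)) := hT ▸ ⟨u, hu, rfl⟩
    exact h
  have hflat : ∀ u ∈ T.toSubmodule, (∀ i, (u i).fst = 0) →
      (fun i => (u i).snd) ∈ S.toSubmodule := by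
    intro u hu h0
    obtain ⟨j, hj⟩ := Module.projective_def'.1 T.projective_quotient
    let w : Fin 4 → L[ε] := fun i => inl (u i).snd
    have hw : (ε : L[ε]) • w = u := by
      funext i
      ext
      · simp [w, h0 i]
      · simp [w]
    have hx : (ε : L[ε]) • j (T.toSubmodule.mkQ w) = 0 := by
      rw [← map_smul, ← map_smul, hw]
      have : T.toSubmodule.mkQ u = 0 := (Submodule.Quotient.mk_eq_zero _).2 hu
      rw [this, map_zero]
    let x := j (T.toSubmodule.mkQ w)
    let x' : ((Fin 4 → L[ε]) ⧸ T.toSubmodule) →₀ L[ε] := x.mapRange (fun c : L[ε] => (inl c.snd : L[ε])) (by simp)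
    have hxx : x = (ε : L[ε]) • x' := by
      refine Finsupp.ext fun q => ?_
      have hq := congrArg TrivSqZeroExt.snd (DFunLike.congr_fun hx q)
      have hq' : (x q).fst = 0 := by simpa [x] using hq
      ext
      · simp [hq']
      · have h : x' q = inl (x q).snd := rfl
        simp [h]
    obtain ⟨w', hw'⟩ := T.toSubmodule.mkQ_surjective (Finsupp.linearCombination L[ε] id x')
    have h1 : T.toSubmodule.mkQ w = (ε : L[ε]) • T.toSubmodule.mkQ w' := by
      rw [hw', ← map_smul, ← hxx]
      exact (LinearMap.congr_fun hj (T.toSubmodule.mkQ w)).symm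
    have h2 : w - (ε : L[ε]) • w' ∈ T.toSubmodule := by
      rw [← Submodule.Quotient.mk_eq_zero]
      change T.toSubmodule.mkQ (w - (ε : L[ε]) • w') = 0
      rw [map_sub, map_smul, h1, sub_self]
    have h3 := hmem _ h2
    have h4 : (fun i => ((w - (ε : L[ε]) • w') i).fst) = fun i => (u i).snd := by
      funext i; simp [w]
    rwa [h4] at h3
  have hdiff : ∀ u ∈ T.toSubmodule, ∀ v ∈ T.toSubmodule, (∀ i, (u i).fst = (v i).fst) →
      S.toSubmodule.mkQ (fun i => (u i).snd) = S.toSubmodule.mkQ fun i => (v i).snd := by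
    intro u hu v hv h
    refine (Submodule.Quotient.eq _).2 ?_
    exact hflat _ (T.toSubmodule.sub_mem hu hv) fun i => by simp [h i]
  have hex : ∀ s : S.toSubmodule, ∃ u ∈ T.toSubmodule, ∀ i, (u i).fst = s.1 i := fun s => by
    have h : s.1 ∈ (S.toSubmodule : Set (Fin 4 → L)) := s.2
    rw [← hT] at h
    obtain ⟨u, hu, hus⟩ := h
    exact ⟨u, hu, fun i => congrFun hus i⟩
  choose t ht hts using hex
  let θ : S.toSubmodule →ₗ[L] (Fin 4 → L) ⧸ S.toSubmodule :=
    { toFun := fun s => S.toSubmodule.mkQ fun i => (t s i).snd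
      map_add' := fun a b => by
        rw [← map_add]
        exact hdiff _ (ht _) _ (T.toSubmodule.add_mem (ht a) (ht b)) fun i => by simp [hts]
      map_smul' := fun c a => by
        rw [RingHom.id_apply, ← map_smul]
        refine (hdiff _ (ht _) _ (T.toSubmodule.smul_mem (inl c : L[ε]) (ht a))
          fun i => by simp [hts]).trans ?_
        congr 1
        funext i
        simp }
  refine ⟨θ, Grassmannian.ext (Submodule.ext fun u => ⟨fun hu => ?_, fun hu => ?_⟩), ?_⟩
  · exact mem_deformationSubmodule.2 ⟨hmem u hu, hdiff _ hu _ (ht _) fun i => by rw [hts]⟩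
  · obtain ⟨h1, h2⟩ := mem_deformationSubmodule.1 hu
    have h3 := (Submodule.Quotient.eq _).1 h2
    have h4 : u - t ⟨_, h1⟩ = (ε : L[ε]) • t ⟨_, h3⟩ := by
      funext i
      ext
      · simp [hts]
      · simp [hts]
    have h5 : u = t ⟨_, h1⟩ + (ε : L[ε]) • t ⟨_, h3⟩ := by rw [← h4]; abel
    rw [h5]
    exact T.toSubmodule.add_mem (ht _) (T.toSubmodule.smul_mem _ (ht _))
  · rintro θ' rfl
    refine LinearMap.ext fun s => ?_
    obtain ⟨h1, h2⟩ := mem_deformationSubmodule.1 (ht s)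
    have h3 : (⟨fun i => (t s i).fst, h1⟩ : S.toSubmodule) = s := Subtype.ext (funext (hts s))
    rw [h3] at h2
    exact h2.symm

/-- `D` is the differential of the section `σ_f` at the zero `S`. For `θ` in the tangent space
`Hom(S, L^4 / S)`, with corresponding point `S̃` of `Gr(4, 2)(L[ε])`, the value `σ_f(S̃)` is
`ε D(θ)`, where multiplication by `ε` identifies the fibre `E(S) = E(S̃) / ε E(S̃)` with
`ε E(S̃)`. -/
def IsDifferential (f : MvPolynomial (Fin 4) k) (hf : f.IsHomogeneous 3) (S : Gr42 L)
    (D : (S.toSubmodule →ₗ[L] (Fin 4 → L) ⧸ S.toSubmodule) →ₗ[L] E S) : Prop :=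
  ∀ θ, ∃ g : E (deformation S θ),
    redSym S θ g.1 = (D θ).1 ∧ sigma f hf (deformation S θ) = (ε : L[ε]) • g

/-- `S` is a simple zero of `σ_f`: a zero at which the differential of `σ_f`, a linear map
`Hom(S, L^4 / S) → Sym³(S^∨)` of 4-dimensional spaces, is an isomorphism (that is, the Jacobian
determinant of `σ_f` does not vanish at `S`). -/
def IsSimpleZero (f : MvPolynomial (Fin 4) k) (hf : f.IsHomogeneous 3) (S : Gr42 L) : Prop :=
  sigma f hf S = 0 ∧
    ∃ D : (S.toSubmodule →ₗ[L] (Fin 4 → L) ⧸ S.toSubmodule) →ₗ[L] E S,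
      IsDifferential f hf S D ∧ Function.Bijective D

end Tangent

section Surface

variable {k : Type*} [Field k] {L : Type*} [Field L] [Algebra k L]

/-- `f` and all its partial derivatives vanish at `v`. For `v ≠ 0` this says that the point `[v]`
is a singular point of the hypersurface `{f = 0}`. -/
def SingularAt (f : MvPolynomial (Fin 4) k) (v : Fin 4 → L) : Prop :=
  aeval v f = 0 ∧ ∀ i, aeval v (pderiv i f) = 0

/-- The surface `{f = 0} ⊆ ℙ³` over `k` is smooth over `k`: it has no singular point over an
algebraic closure of `k`. -/
def IsSmoothSurface (f : MvPolynomial (Fin 4) k) : Prop :=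
  ∀ v : Fin 4 → AlgebraicClosure k, v ≠ 0 → ¬ SingularAt f v

/-- The homogeneous ideal of the line in `ℙ³` over `L` defined by `S ⊆ L^4`: it is generated by the
linear forms that vanish on `S`. -/
noncomputable def lineIdeal (S : Gr42 L) : Ideal (MvPolynomial (Fin 4) L) :=
  Ideal.span {p | ∃ c : Fin 4 → L, (∀ s ∈ S.toSubmodule, ∑ i, c i * s i = 0) ∧
    p = ∑ i, C (c i) * X i}

/-- The line defined by `S` is contained in the surface `{f = 0}` (extended to `L`). -/
def LineOn (S : Gr42 L) (f : MvPolynomial (Fin 4) k) : Prop :=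
  map (algebraMap k L) f ∈ lineIdeal S

/-- The surface `{f = 0}` is smooth along the line defined by `S`: no point of the line, over an
algebraic closure of `L`, is a singular point of the surface. -/
def IsSmoothAlong (f : MvPolynomial (Fin 4) k) (S : Gr42 L) : Prop :=
  ∀ v ∈ Submodule.span (AlgebraicClosure L)
      ((fun s i => algebraMap L (AlgebraicClosure L) (s i)) '' (S.toSubmodule : Set (Fin 4 → L))),
    v ≠ 0 → ¬ SingularAt f v

end Surface

end CubicLines

/-! Choose a splitting `L^4 = S ⊕ L^4/S`, with projection `p` onto `S` and section `j` of the
quotient map. A first-order Taylor expansion over `L[ε]`, which is formal and hence valid in every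
characteristic, shows that at a zero `S` the differential is `θ ↦ ∑ i, (∂f/∂x_i)|S · x_i(j ∘ θ)`
(`isDifferential_gradientMap`). The tangent space has dimension 4 and `Sym³(S^∨)` has dimension at
most 4, so injectivity suffices.

In bases of `S` and `L^4/S`, a kernel element `θ` is a pair of binary linear forms `a`, `b` with `a
p + b r = 0`, where the binary quadratic forms `p`, `r` are the derivatives of `f` in two directions
normal to `S`, restricted to `S`. If `θ ≠ 0`, then `p` and `r` have a common zero on the line over
an algebraic closure (`exists_common_zero_of_linear_syzygy`): either `p = b ℓ` and `r = -a ℓ` with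
`ℓ` linear, or `p` and `r` are proportional. There the normal derivatives of `f` vanish, and the
derivatives along `S` vanish because `f|S = 0`. The point is therefore singular, contradicting
smoothness along the line.

This gives (2). For (1), the Nullstellensatz carries smoothness over `k` to all extension fields. -/

theorem MvPolynomial.eval₂_add_mul_of_mul_self_eq_zero {R B σ : Type*} [CommSemiring R] [CommRing B]
    [Fintype σ] (φ : R →+* B) (x h : σ → B) {e : B} (he : e * e = 0) (f : MvPolynomial σ R) :
    eval₂ φ (fun i => x i + e * h i) f =
      eval₂ φ x f + e * ∑ i, eval₂ φ x (pderiv i f) * h i := by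
  classical
  induction f using MvPolynomial.induction_on with
  | C a => simp
  | add p q hp hq =>
    simp only [eval₂_add, hp, hq, map_add, add_mul, Finset.sum_add_distrib]
    ring
  | mul_X p n hp =>
    have hs : ∑ i, eval₂ φ x (pderiv i (p * X n)) * h i =
        eval₂ φ x p * h n + x n * ∑ i, eval₂ φ x (pderiv i p) * h i := by
      rw [Finset.mul_sum]
      simp only [pderiv_mul, pderiv_X, eval₂_add, eval₂_mul, eval₂_X, add_mul,
        Finset.sum_add_distrib]
      rw [add_comm]
      congr 1
      · rw [Finset.sum_eq_single n]
        · simp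
        · intro i _ hi
          simp [hi.symm]
        · simp
      · exact Finset.sum_congr rfl fun i _ => by ring
    rw [eval₂_mul, eval₂_X, hp, hs, eval₂_mul, eval₂_X]
    linear_combination (∑ i, eval₂ φ x (pderiv i p) * h i) * h n * he

/-! ### Syzygies of binary forms. -/

section BinaryForms

variable {K : Type*} [Field K]

theorem IsAlgClosed.exists_binaryQuadratic_eq_zero [IsAlgClosed K] (r₀ r₁ r₂ : K) :
    ∃ x y : K, (x ≠ 0 ∨ y ≠ 0) ∧ r₀ * x ^ 2 + r₁ * (x * y) + r₂ * y ^ 2 = 0 := by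
  by_cases h : r₀ = 0
  · exact ⟨1, 0, by simp, by simp [h]⟩
  · obtain ⟨z, hz⟩ := IsAlgClosed.exists_root
      (Polynomial.C r₀ * Polynomial.X ^ 2 + Polynomial.C r₁ * Polynomial.X + Polynomial.C r₂)
      (by rw [Polynomial.degree_quadratic h]; decide)
    refine ⟨z, 1, by simp, ?_⟩
    simpa [Polynomial.IsRoot] using hz

/-- If `a p + b r = 0` for binary linear forms `a`, `b`, not both zero, and binary quadratic forms
`p`, `r`, then `p` and `r` have a common zero over an algebraically closed field. -/
theorem IsAlgClosed.exists_common_zero_of_linear_syzygy [IsAlgClosed K]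
    {a₀ a₁ b₀ b₁ p₀ p₁ p₂ r₀ r₁ r₂ : K} (hne : ¬ (a₀ = 0 ∧ a₁ = 0 ∧ b₀ = 0 ∧ b₁ = 0))
    (h₀ : a₀ * p₀ + b₀ * r₀ = 0) (h₁ : a₀ * p₁ + a₁ * p₀ + b₀ * r₁ + b₁ * r₀ = 0)
    (h₂ : a₀ * p₂ + a₁ * p₁ + b₀ * r₂ + b₁ * r₁ = 0) (h₃ : a₁ * p₂ + b₁ * r₂ = 0) :
    ∃ x y : K, (x ≠ 0 ∨ y ≠ 0) ∧ p₀ * x ^ 2 + p₁ * (x * y) + p₂ * y ^ 2 = 0 ∧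
      r₀ * x ^ 2 + r₁ * (x * y) + r₂ * y ^ 2 = 0 := by
  -- A constant relation `l p + m r = 0` makes one form a multiple of the other, so a zero of that
  -- other form is a common zero.
  have prop : ∀ l m : K, (l ≠ 0 ∨ m ≠ 0) → l * p₀ + m * r₀ = 0 → l * p₁ + m * r₁ = 0 →
      l * p₂ + m * r₂ = 0 → ∃ x y : K, (x ≠ 0 ∨ y ≠ 0) ∧
        p₀ * x ^ 2 + p₁ * (x * y) + p₂ * y ^ 2 = 0 ∧
        r₀ * x ^ 2 + r₁ * (x * y) + r₂ * y ^ 2 = 0 := by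
    rintro l m (hl | hm) e₀ e₁ e₂
    · obtain ⟨x, y, hxy, h⟩ := exists_binaryQuadratic_eq_zero r₀ r₁ r₂
      refine ⟨x, y, hxy, mul_left_cancel₀ hl ?_, h⟩
      linear_combination x ^ 2 * e₀ + x * y * e₁ + y ^ 2 * e₂ - m * h
    · obtain ⟨x, y, hxy, h⟩ := exists_binaryQuadratic_eq_zero p₀ p₁ p₂
      refine ⟨x, y, hxy, h, mul_left_cancel₀ hm ?_⟩
      linear_combination x ^ 2 * e₀ + x * y * e₁ + y ^ 2 * e₂ - l * h
  -- This determinant vanishes exactly when `a` and `b` are proportional. They then share a linear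
  -- factor, `y` or `x + t y`, and cancelling it leaves a constant relation.
  by_cases hΔ : a₀ * b₁ - a₁ * b₀ = 0
  · by_cases h : a₀ = 0 ∧ b₀ = 0
    · obtain ⟨rfl, rfl⟩ := h
      refine prop a₁ b₁ ?_ ?_ ?_ h₃
      · by_contra! hc
        exact hne ⟨rfl, hc.1, rfl, hc.2⟩
      · linear_combination h₁
      · linear_combination h₂
    · obtain ⟨t, rfl, rfl⟩ : ∃ t, a₁ = t * a₀ ∧ b₁ = t * b₀ := by
        by_cases ha : a₀ = 0
        · have hb : b₀ ≠ 0 := fun hb => h ⟨ha, hb⟩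
          refine ⟨b₁ / b₀, ?_, by field_simp⟩
          subst ha
          have : a₁ = 0 := by simpa [hb] using hΔ
          simp [this]
        · refine ⟨a₁ / a₀, by field_simp, ?_⟩
          field_simp
          linear_combination hΔ
      refine prop a₀ b₀ (by by_contra! hc; exact h hc) h₀ ?_ ?_
      · linear_combination h₁ - t * h₀
      · linear_combination h₂ - t * h₁ + t ^ 2 * h₀
  -- With `Δ = a₀ b₁ - a₁ b₀` and `ℓ = X y - Y x`, for `X`, `Y` the two expressions below, the
  -- syzygy gives `Δ p = b ℓ` and `Δ r = -a ℓ`. The root of `ℓ` is `(X, Y)`. If `X = Y = 0`, both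
  -- forms vanish identically and `(1, 0)` serves.
  · by_cases hm : a₀ * p₂ + b₀ * r₂ = 0 ∧ b₁ * r₀ + a₁ * p₀ = 0
    · obtain ⟨m₁, m₀⟩ := hm
      refine ⟨1, 0, by simp, mul_left_cancel₀ hΔ ?_, mul_left_cancel₀ hΔ ?_⟩
      · linear_combination b₁ * h₀ - b₀ * m₀
      · linear_combination a₀ * m₀ - a₁ * h₀
    · set X := a₀ * p₂ + b₀ * r₂
      set Y := b₁ * r₀ + a₁ * p₀
      have ep₀ : (a₀ * b₁ - a₁ * b₀) * p₀ = -b₀ * Y := by linear_combination b₁ * h₀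
      have ep₁ : (a₀ * b₁ - a₁ * b₀) * p₁ = b₀ * X - b₁ * Y := by
        linear_combination b₁ * h₁ - b₀ * h₂
      have ep₂ : (a₀ * b₁ - a₁ * b₀) * p₂ = b₁ * X := by linear_combination -b₀ * h₃
      have er₀ : (a₀ * b₁ - a₁ * b₀) * r₀ = a₀ * Y := by linear_combination -a₁ * h₀
      have er₁ : (a₀ * b₁ - a₁ * b₀) * r₁ = a₁ * Y - a₀ * X := by
        linear_combination a₀ * h₂ - a₁ * h₁
      have er₂ : (a₀ * b₁ - a₁ * b₀) * r₂ = -a₁ * X := by linear_combination a₀ * h₃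
      clear_value X Y
      refine ⟨X, Y, by by_contra! hc; exact hm hc,
        mul_left_cancel₀ hΔ ?_, mul_left_cancel₀ hΔ ?_⟩
      · linear_combination X ^ 2 * ep₀ + X * Y * ep₁ + Y ^ 2 * ep₂
      · linear_combination X ^ 2 * er₀ + X * Y * er₁ + Y ^ 2 * er₂

/-- Setting `x = 1` leaves a polynomial in `y` that vanishes on an infinite field. This turns a
syzygy checked at points into the coefficient identities of the previous lemma. -/
theorem eq_zero_of_binaryCubic_eq_zero [Infinite K] {c₀ c₁ c₂ c₃ : K}
    (h : ∀ x y : K, c₀ * x ^ 3 + c₁ * (x ^ 2 * y) + c₂ * (x * y ^ 2) + c₃ * y ^ 3 = 0) :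
    c₀ = 0 ∧ c₁ = 0 ∧ c₂ = 0 ∧ c₃ = 0 := by
  have hp : (Polynomial.C c₀ + Polynomial.C c₁ * Polynomial.X + Polynomial.C c₂ * Polynomial.X ^ 2 +
      Polynomial.C c₃ * Polynomial.X ^ 3 : Polynomial K) = 0 := by
    refine Polynomial.funext fun y => ?_
    simpa using h 1 y
  have hc := fun n => congrArg (fun q => Polynomial.coeff q n) hp
  refine ⟨by simpa [Polynomial.coeff_X, Polynomial.coeff_X_pow, Polynomial.coeff_C] using hc 0,
    by simpa [Polynomial.coeff_X, Polynomial.coeff_X_pow, Polynomial.coeff_C] using hc 1,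
    by simpa [Polynomial.coeff_X, Polynomial.coeff_X_pow, Polynomial.coeff_C] using hc 2,
    by simpa [Polynomial.coeff_X, Polynomial.coeff_X_pow, Polynomial.coeff_C] using hc 3⟩

end BinaryForms

/-! ### Degrees and dimensions. -/

namespace CubicLines

section Bundle

variable {k : Type*} [Field k] {A : Type*} [CommRing A] [Algebra k A]

/-- Needed in degree 2, for the partial derivatives of the cubic. -/
theorem restrict_mem_pow {n : ℕ} {f : MvPolynomial (Fin 4) k} (hf : f.IsHomogeneous n)
    (S : Gr42 A) :
    restrict f S ∈ LinearMap.range (SymmetricAlgebra.ι A (Dual A S.toSubmodule)) ^ n := by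
  rw [restrict, eval₂_eq']
  refine Submodule.sum_mem _ fun d hd => ?_
  rw [RingHom.comp_apply, ← Algebra.smul_def]
  refine Submodule.smul_mem _ _ ?_
  have hdeg : ∑ i, d i = n := by
    have h := hf (mem_support_iff.mp hd)
    rw [Finsupp.weight_apply, Finsupp.sum_fintype _ _ (by simp)] at h
    simpa using h
  rw [← hdeg]
  induction (Finset.univ : Finset (Fin 4)) using Finset.cons_induction with
  | empty => simp [Submodule.one_le.mp le_rfl]
  | cons a s ha ih =>
    rw [Finset.prod_cons, Finset.sum_cons, pow_add]
    exact Submodule.mul_mem_mul (Submodule.pow_mem_pow _ (LinearMap.mem_range_self _ _) _) ih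

end Bundle

variable {L : Type*} [Field L]

theorem finrank_toSubmodule (S : Gr42 L) : finrank L S.toSubmodule = 2 := by
  have h := S.rankAtStalk_eq ⊥
  rw [rankAtStalk_eq_finrank_of_free] at h
  have h' := S.toSubmodule.finrank_quotient_add_finrank
  simp at h h'
  omega

theorem finrank_quotient (S : Gr42 L) : finrank L ((Fin 4 → L) ⧸ S.toSubmodule) = 2 := by
  have h := S.rankAtStalk_eq ⊥
  rwa [rankAtStalk_eq_finrank_of_free] at h

theorem finrank_tangent (S : Gr42 L) :
    finrank L (S.toSubmodule →ₗ[L] (Fin 4 → L) ⧸ S.toSubmodule) = 4 := by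
  rw [finrank_linearMap, finrank_toSubmodule, finrank_quotient]

/-- The four cubic monomials in a basis of `S^∨` span. Their independence is not needed: an
injection from the 4-dimensional tangent space forces dimension 4. -/
theorem exists_E_le_span (S : Gr42 L) :
    ∃ t : Finset (SymmetricAlgebra L (Dual L S.toSubmodule)), t.card ≤ 4 ∧
      E S = Submodule.span L (t : Set (SymmetricAlgebra L (Dual L S.toSubmodule))) := by
  classical
  let b : Basis (Fin 2) L (Dual L S.toSubmodule) :=
    finBasisOfFinrankEq L _ (by rw [Subspace.dual_finrank_eq, finrank_toSubmodule])
  let x := SymmetricAlgebra.ι L _ (b 0)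
  let y := SymmetricAlgebra.ι L _ (b 1)
  have hr : LinearMap.range (SymmetricAlgebra.ι L (Dual L S.toSubmodule)) =
      Submodule.span L {x, y} := by
    rw [LinearMap.range_eq_map, ← b.span_eq, Submodule.map_span, ← Set.range_comp]
    congr 1
    ext z
    simp [Fin.exists_fin_two, x, y, eq_comm]
  refine ⟨{x ^ 3, x ^ 2 * y, x * y ^ 2, y ^ 3}, Finset.card_le_four, ?_⟩
  rw [E, hr, pow_three, Submodule.span_mul_span, Submodule.span_mul_span]
  congr 1
  ext z
  simp only [pow_three, Set.mem_mul, Set.mem_insert_iff, Set.mem_singleton_iff, Finset.coe_insert,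
    Finset.coe_singleton]
  constructor
  · rintro ⟨u, rfl | rfl, _, ⟨v, rfl | rfl, w, rfl | rfl, rfl⟩, rfl⟩
    · exact .inl rfl
    · exact .inr (.inl (by ring))
    · exact .inr (.inl (by ring))
    · exact .inr (.inr (.inl (by ring)))
    · exact .inr (.inl (by ring))
    · exact .inr (.inr (.inl (by ring)))
    · exact .inr (.inr (.inl (by ring)))
    · exact .inr (.inr (.inr rfl))
  · rintro (rfl | rfl | rfl | rfl)
    · exact ⟨x, .inl rfl, _, ⟨x, .inl rfl, x, .inl rfl, rfl⟩, rfl⟩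
    · exact ⟨x, .inl rfl, _, ⟨x, .inl rfl, y, .inr rfl, rfl⟩, by ring⟩
    · exact ⟨x, .inl rfl, _, ⟨y, .inr rfl, y, .inr rfl, rfl⟩, by ring⟩
    · exact ⟨y, .inr rfl, _, ⟨y, .inr rfl, y, .inr rfl, rfl⟩, rfl⟩

theorem bijective_of_injective {S : Gr42 L}
    {D : (S.toSubmodule →ₗ[L] (Fin 4 → L) ⧸ S.toSubmodule) →ₗ[L] E S}
    (hD : Function.Injective D) : Function.Bijective D := by
  obtain ⟨t, ht, hE⟩ := exists_E_le_span S
  have : FiniteDimensional L (E S) := by rw [hE]; infer_instance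
  have h1 : finrank L (E S) ≤ 4 := by
    rw [hE]
    exact (finrank_span_finset_le_card t).trans ht
  have h2 := LinearMap.finrank_le_finrank_of_injective hD
  rw [finrank_tangent] at h2
  exact ⟨hD, (LinearMap.injective_iff_surjective_of_finrank_eq_finrank
    (by rw [finrank_tangent]; omega)).1 hD⟩

/-! ### The differential of `σ_f` as a gradient. -/

section Differential

open DualNumber TrivSqZeroExt

variable {k : Type*} [Field k] [Algebra k L]

/-- The linear map `θ ↦ ∑ i, (∂f/∂x_i)|S · x_i(j ∘ θ)`, where `j` lifts `L^4 / S` to `L^4`. -/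
noncomputable def gradientMap (f : MvPolynomial (Fin 4) k) (hf : f.IsHomogeneous 3) (S : Gr42 L)
    (j : ((Fin 4 → L) ⧸ S.toSubmodule) →ₗ[L] (Fin 4 → L)) :
    (S.toSubmodule →ₗ[L] (Fin 4 → L) ⧸ S.toSubmodule) →ₗ[L] E S where
  toFun θ := ⟨∑ i, restrict (pderiv i f) S *
      SymmetricAlgebra.ι L _ (LinearMap.proj i ∘ₗ j ∘ₗ θ), Submodule.sum_mem _ fun i _ => by
    rw [E, pow_succ]
    exact Submodule.mul_mem_mul (restrict_mem_pow hf.pderiv S) (LinearMap.mem_range_self _ _)⟩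
  map_add' θ η := Subtype.ext (by
    simp [LinearMap.comp_add, mul_add, Finset.sum_add_distrib])
  map_smul' c θ := Subtype.ext (by
    simp [LinearMap.comp_smul, Finset.smul_sum])

/-- The extension of a linear form on `S` to the deformation of `S` attached to `θ`, by means of
a linear map `p : L^4 → S`. -/
noncomputable def extendDual (S : Gr42 L) (θ : S.toSubmodule →ₗ[L] (Fin 4 → L) ⧸ S.toSubmodule)
    (p : (Fin 4 → L) →ₗ[L] S.toSubmodule) :
    Dual L S.toSubmodule →ₛₗ[(inlHom L L : L →+* L[ε])] Dual L[ε] (deformation S θ).toSubmodule where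
  toFun φ :=
    { toFun := fun u => inl (φ (p fun i => (u.1 i).fst)) + inr (φ (p fun i => (u.1 i).snd))
      map_add' := fun u v => by
        have h1 : (fun i => ((u + v).1 i).fst) = (fun i => (u.1 i).fst) + fun i => (v.1 i).fst := rfl
        have h2 : (fun i => ((u + v).1 i).snd) = (fun i => (u.1 i).snd) + fun i => (v.1 i).snd := rfl
        rw [h1, h2]
        ext <;> simp
      map_smul' := fun c u => by
        have h1 : (fun i => ((c • u).1 i).fst) = c.fst • fun i => (u.1 i).fst := rfl
        have h2 : (fun i => ((c • u).1 i).snd) =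
            c.fst • (fun i => (u.1 i).snd) + c.snd • fun i => (u.1 i).fst := by
          funext i; simp
        rw [h1, h2]
        ext <;> simp }
  map_add' φ ψ := LinearMap.ext fun u => by ext <;> simp
  map_smul' c φ := LinearMap.ext fun u => by ext <;> simp

theorem extendDual_apply (S : Gr42 L) (θ : S.toSubmodule →ₗ[L] (Fin 4 → L) ⧸ S.toSubmodule)
    (p : (Fin 4 → L) →ₗ[L] S.toSubmodule) (φ : Dual L S.toSubmodule)
    (u : (deformation S θ).toSubmodule) : extendDual S θ p φ u =
      inl (φ (p fun i => (u.1 i).fst)) + inr (φ (p fun i => (u.1 i).snd)) := rfl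

theorem redDual_extendDual (S : Gr42 L) (θ : S.toSubmodule →ₗ[L] (Fin 4 → L) ⧸ S.toSubmodule)
    {p : (Fin 4 → L) →ₗ[L] S.toSubmodule} (hp : ∀ s : S.toSubmodule, p s = s)
    (φ : Dual L S.toSubmodule) : redDual S θ (extendDual S θ p φ) = φ :=
  LinearMap.ext fun s => by
    rw [redDual_apply S θ _ (liftVec S θ s) s (by simp), extendDual_apply]
    simp [hp]

/-- For `u₀ + ε u₁` in the deformation, `u₁ mod S = θ(u₀)`, so `u₁ = p u₁ + j (θ u₀)`. The first
summand belongs to the extended form and the second is the `ε`-correction. -/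
theorem coord_deformation (S : Gr42 L) (θ : S.toSubmodule →ₗ[L] (Fin 4 → L) ⧸ S.toSubmodule)
    {p : (Fin 4 → L) →ₗ[L] S.toSubmodule} {j : ((Fin 4 → L) ⧸ S.toSubmodule) →ₗ[L] (Fin 4 → L)}
    (hpj : ∀ v, (p v : Fin 4 → L) + j (S.toSubmodule.mkQ v) = v)
    (hp : ∀ s : S.toSubmodule, p s = s) (i : Fin 4) :
    coord (deformation S θ) i = extendDual S θ p (coord S i) +
      (ε : L[ε]) • extendDual S θ p (LinearMap.proj i ∘ₗ j ∘ₗ θ) := by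
  refine LinearMap.ext fun u => ?_
  obtain ⟨h1, h2⟩ := mem_deformationSubmodule.1 u.2
  have h3 : p (fun i => (u.1 i).fst) = ⟨_, h1⟩ := hp ⟨_, h1⟩
  rw [LinearMap.add_apply, LinearMap.smul_apply, extendDual_apply, extendDual_apply, h3]
  have h4 := congrFun (hpj fun i => (u.1 i).snd) i
  rw [h2] at h4
  ext
  · simp [coord]
  · simpa [coord] using h4.symm

/-- The ring homomorphism `Sym(S^∨) → Sym(S̃^∨)` induced by `extendDual`. -/
noncomputable def extendSym (S : Gr42 L) (θ : S.toSubmodule →ₗ[L] (Fin 4 → L) ⧸ S.toSubmodule)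
    (p : (Fin 4 → L) →ₗ[L] S.toSubmodule) :
    SymmetricAlgebra L (Dual L S.toSubmodule) →+*
      SymmetricAlgebra L[ε] (Dual L[ε] (deformation S θ).toSubmodule) :=
  letI : Algebra L (SymmetricAlgebra L[ε] (Dual L[ε] (deformation S θ).toSubmodule)) :=
    ((algebraMap L[ε] _).comp (inlHom L L)).toAlgebra
  (SymmetricAlgebra.lift
    { toFun := fun φ => SymmetricAlgebra.ι L[ε] _ (extendDual S θ p φ)
      map_add' := fun φ ψ => by rw [map_add, map_add]
      map_smul' := fun c φ => by
        rw [LinearMap.map_smulₛₗ, map_smul, RingHom.id_apply, Algebra.smul_def, Algebra.smul_def]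
        rfl } :
    SymmetricAlgebra L (Dual L S.toSubmodule) →ₐ[L] _).toRingHom

@[simp] theorem extendSym_ι (S : Gr42 L) (θ : S.toSubmodule →ₗ[L] (Fin 4 → L) ⧸ S.toSubmodule)
    (p : (Fin 4 → L) →ₗ[L] S.toSubmodule) (φ : Dual L S.toSubmodule) :
    extendSym S θ p (SymmetricAlgebra.ι L _ φ) =
      SymmetricAlgebra.ι L[ε] _ (extendDual S θ p φ) :=
  letI : Algebra L (SymmetricAlgebra L[ε] (Dual L[ε] (deformation S θ).toSubmodule)) :=
    ((algebraMap L[ε] _).comp (inlHom L L)).toAlgebra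
  SymmetricAlgebra.lift_ι_apply _ _

@[simp] theorem extendSym_algebraMap (S : Gr42 L)
    (θ : S.toSubmodule →ₗ[L] (Fin 4 → L) ⧸ S.toSubmodule)
    (p : (Fin 4 → L) →ₗ[L] S.toSubmodule) (c : L) :
    extendSym S θ p (algebraMap L _ c) = algebraMap L[ε] _ (inl c) :=
  letI : Algebra L (SymmetricAlgebra L[ε] (Dual L[ε] (deformation S θ).toSubmodule)) :=
    ((algebraMap L[ε] _).comp (inlHom L L)).toAlgebra
  AlgHom.commutes _ _

/-- `extendSym` is a section of reduction modulo `ε`, so it supplies the lift of the differential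
that `IsDifferential` asks for. -/
theorem redSym_extendSym (S : Gr42 L) (θ : S.toSubmodule →ₗ[L] (Fin 4 → L) ⧸ S.toSubmodule)
    {p : (Fin 4 → L) →ₗ[L] S.toSubmodule} (hp : ∀ s : S.toSubmodule, p s = s)
    (z : SymmetricAlgebra L (Dual L S.toSubmodule)) : redSym S θ (extendSym S θ p z) = z := by
  induction z using SymmetricAlgebra.induction with
  | algebraMap r => simp
  | ι x => rw [extendSym_ι, redSym_ι, redDual_extendDual S θ hp]
  | mul a b ha hb => rw [map_mul, map_mul, ha, hb]
  | add a b ha hb => rw [map_add, map_add, ha, hb]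

theorem extendSym_mem (S : Gr42 L) (θ : S.toSubmodule →ₗ[L] (Fin 4 → L) ⧸ S.toSubmodule)
    (p : (Fin 4 → L) →ₗ[L] S.toSubmodule) {n : ℕ} {z : SymmetricAlgebra L (Dual L S.toSubmodule)}
    (hz : z ∈ LinearMap.range (SymmetricAlgebra.ι L (Dual L S.toSubmodule)) ^ n) :
    extendSym S θ p z ∈ LinearMap.range
      (SymmetricAlgebra.ι L[ε] (Dual L[ε] (deformation S θ).toSubmodule)) ^ n := by
  induction hz using Submodule.pow_induction_on_left' with
  | algebraMap r => simp
  | add x y i hx hy ihx ihy => rw [map_add]; exact add_mem ihx ihy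
  | mem_mul m hm i x hx ih =>
    obtain ⟨φ, rfl⟩ := hm
    rw [map_mul, extendSym_ι, pow_succ']
    exact Submodule.mul_mem_mul (LinearMap.mem_range_self _ _) ih

theorem extendSym_restrict (f : MvPolynomial (Fin 4) k) (S : Gr42 L)
    (θ : S.toSubmodule →ₗ[L] (Fin 4 → L) ⧸ S.toSubmodule) (p : (Fin 4 → L) →ₗ[L] S.toSubmodule) :
    extendSym S θ p (restrict f S) = eval₂ ((algebraMap L[ε] _).comp (algebraMap k L[ε]))
      (fun i => SymmetricAlgebra.ι L[ε] _ (extendDual S θ p (coord S i))) f := by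
  rw [restrict, ← coe_eval₂Hom, ← coe_eval₂Hom, ← RingHom.comp_apply]
  congr 1
  refine MvPolynomial.ringHom_ext (fun r => ?_) fun i => ?_
  · simp [TrivSqZeroExt.algebraMap_eq_inl']
  · simp

theorem gradientMap_coe (f : MvPolynomial (Fin 4) k) (hf : f.IsHomogeneous 3) (S : Gr42 L)
    (j : ((Fin 4 → L) ⧸ S.toSubmodule) →ₗ[L] (Fin 4 → L))
    (θ : S.toSubmodule →ₗ[L] (Fin 4 → L) ⧸ S.toSubmodule) :
    (gradientMap f hf S j θ : SymmetricAlgebra L (Dual L S.toSubmodule)) =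
      ∑ i, restrict (pderiv i f) S * SymmetricAlgebra.ι L _ (LinearMap.proj i ∘ₗ j ∘ₗ θ) := rfl

theorem restrict_deformation (f : MvPolynomial (Fin 4) k) (S : Gr42 L)
    (θ : S.toSubmodule →ₗ[L] (Fin 4 → L) ⧸ S.toSubmodule)
    {p : (Fin 4 → L) →ₗ[L] S.toSubmodule} {j : ((Fin 4 → L) ⧸ S.toSubmodule) →ₗ[L] (Fin 4 → L)}
    (hpj : ∀ v, (p v : Fin 4 → L) + j (S.toSubmodule.mkQ v) = v)
    (hp : ∀ s : S.toSubmodule, p s = s) :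
    restrict f (deformation S θ) = extendSym S θ p (restrict f S) +
      algebraMap L[ε] _ ε * ∑ i, extendSym S θ p (restrict (pderiv i f) S) *
        SymmetricAlgebra.ι L[ε] _ (extendDual S θ p (LinearMap.proj i ∘ₗ j ∘ₗ θ)) := by
  have hε : (algebraMap L[ε] (SymmetricAlgebra L[ε] (Dual L[ε] (deformation S θ).toSubmodule)) ε) *
      algebraMap L[ε] _ ε = 0 := by rw [← map_mul, DualNumber.eps_mul_eps, map_zero]
  have hc : (fun i => SymmetricAlgebra.ι L[ε] _ (coord (deformation S θ) i)) = fun i =>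
      SymmetricAlgebra.ι L[ε] _ (extendDual S θ p (coord S i)) + algebraMap L[ε] _ ε *
        SymmetricAlgebra.ι L[ε] _ (extendDual S θ p (LinearMap.proj i ∘ₗ j ∘ₗ θ)) := by
    funext i
    rw [coord_deformation S θ hpj hp, map_add, map_smul, Algebra.smul_def]
  simp only [extendSym_restrict]
  rw [restrict, hc]
  exact eval₂_add_mul_of_mul_self_eq_zero _ _ _ hε f

/-- In the Taylor expansion of `f` on the deformation the constant term is the extension of `f|S =
0`. What remains is `ε` times the extension of the gradient expression. -/
theorem isDifferential_gradientMap (f : MvPolynomial (Fin 4) k) (hf : f.IsHomogeneous 3)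
    (S : Gr42 L) (h0 : sigma f hf S = 0)
    {p : (Fin 4 → L) →ₗ[L] S.toSubmodule} {j : ((Fin 4 → L) ⧸ S.toSubmodule) →ₗ[L] (Fin 4 → L)}
    (hpj : ∀ v, (p v : Fin 4 → L) + j (S.toSubmodule.mkQ v) = v)
    (hp : ∀ s : S.toSubmodule, p s = s) : IsDifferential f hf S (gradientMap f hf S j) := by
  intro θ
  refine ⟨⟨extendSym S θ p (gradientMap f hf S j θ), extendSym_mem S θ p (Subtype.prop _)⟩,
    redSym_extendSym S θ hp _, Subtype.ext ?_⟩
  have h : restrict f S = 0 := congrArg Subtype.val h0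
  change restrict f (deformation S θ) = (ε : L[ε]) • extendSym S θ p _
  rw [restrict_deformation f S θ hpj hp, h, map_zero, zero_add, gradientMap_coe, map_sum,
    Algebra.smul_def]
  simp only [map_mul, extendSym_ι]

end Differential

end CubicLines

/-! ### Injectivity of the differential along a smooth line. -/

namespace CubicLines

variable {k : Type*} [Field k] {L : Type*} [Field L]

/-- Evaluation of polynomial functions on `S` at the point `x s₀ + y s₁`. -/
noncomputable def lineEval (S : Gr42 L) (s₀ s₁ : S.toSubmodule) {B : Type*} [CommRing B]
    [Algebra L B] (x y : B) : SymmetricAlgebra L (Dual L S.toSubmodule) →ₐ[L] B :=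
  SymmetricAlgebra.lift ((Dual.eval L _ s₀).smulRight x + (Dual.eval L _ s₁).smulRight y)

@[simp] theorem lineEval_ι (S : Gr42 L) (s₀ s₁ : S.toSubmodule) {B : Type*} [CommRing B]
    [Algebra L B] (x y : B) (φ : Dual L S.toSubmodule) :
    lineEval S s₀ s₁ x y (SymmetricAlgebra.ι L _ φ) = φ s₀ • x + φ s₁ • y :=
  SymmetricAlgebra.lift_ι_apply _ _

theorem lineEval_restrict [Algebra k L] (f : MvPolynomial (Fin 4) k) (S : Gr42 L)
    (s₀ s₁ : S.toSubmodule) {B : Type*} [CommRing B] [Algebra L B] (x y : B) :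
    lineEval S s₀ s₁ x y (restrict f S) =
      eval₂ ((algebraMap L B).comp (algebraMap k L)) (fun i => s₀.1 i • x + s₁.1 i • y) f := by
  rw [restrict, ← coe_eval₂Hom, ← coe_eval₂Hom, ← AlgHom.coe_toRingHom, ← RingHom.comp_apply]
  congr 1
  refine MvPolynomial.ringHom_ext (fun r => ?_) fun i => ?_
  · simp
  · simp [coord]

theorem exists_lineEval_eq_quadratic (S : Gr42 L) (s₀ s₁ : S.toSubmodule) (B : Type*) [CommRing B]
    [Algebra L B] {z : SymmetricAlgebra L (Dual L S.toSubmodule)}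
    (hz : z ∈ LinearMap.range (SymmetricAlgebra.ι L (Dual L S.toSubmodule)) ^ 2) :
    ∃ p₀ p₁ p₂ : B, ∀ x y : B,
      lineEval S s₀ s₁ x y z = p₀ * x ^ 2 + p₁ * (x * y) + p₂ * y ^ 2 := by
  rw [pow_two] at hz
  refine Submodule.mul_induction_on hz ?_ ?_
  · rintro _ ⟨φ, rfl⟩ _ ⟨ψ, rfl⟩
    refine ⟨algebraMap L B (φ s₀ * ψ s₀), algebraMap L B (φ s₀ * ψ s₁ + φ s₁ * ψ s₀),
      algebraMap L B (φ s₁ * ψ s₁), fun x y => ?_⟩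
    simp only [map_mul, lineEval_ι, Algebra.smul_def, map_add]
    ring
  · rintro a b ⟨p₀, p₁, p₂, hp⟩ ⟨r₀, r₁, r₂, hr⟩
    refine ⟨p₀ + r₀, p₁ + r₁, p₂ + r₂, fun x y => ?_⟩
    rw [map_add, hp, hr]
    ring

open DualNumber TrivSqZeroExt in
/-- If `f` vanishes on `S`, then so do its derivatives along `S`. -/
theorem sum_smul_pderiv_eq_zero [Algebra k L] {f : MvPolynomial (Fin 4) k} {S : Gr42 L}
    (h0 : restrict f S = 0) (s₀ s₁ : S.toSubmodule) {K : Type*} [Field K] [Algebra L K]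
    (x y c d : K) :
    ∑ i, eval₂ ((algebraMap L K).comp (algebraMap k L)) (fun i => s₀.1 i • x + s₁.1 i • y)
      (pderiv i f) * (s₀.1 i • c + s₁.1 i • d) = 0 := by
  -- Evaluate `f|S = 0` at `(x + ε c, y + ε d)`; the coefficient of `ε` is the derivative of `f`
  -- along `c s₀ + d s₁`.
  have h := lineEval_restrict f S s₀ s₁ (inl x + inr c : K[ε]) (inl y + inr d)
  rw [h0, map_zero] at h
  have hin : ∀ g : MvPolynomial (Fin 4) k,
      eval₂ ((algebraMap L K[ε]).comp (algebraMap k L))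
        (fun i => (inl (s₀.1 i • x + s₁.1 i • y) : K[ε])) g =
      inl (eval₂ ((algebraMap L K).comp (algebraMap k L))
        (fun i => s₀.1 i • x + s₁.1 i • y) g) := fun g => by
    change _ = inlHom K K _
    rw [hom_eval₂]
    rfl
  have hv : (fun i => s₀.1 i • (inl x + inr c : K[ε]) + s₁.1 i • (inl y + inr d)) = fun i =>
      inl (s₀.1 i • x + s₁.1 i • y) + (ε : K[ε]) * inl (s₀.1 i • c + s₁.1 i • d) := by
    funext i
    ext <;> simp
  rw [hv, eval₂_add_mul_of_mul_self_eq_zero _ _ _ DualNumber.eps_mul_eps] at h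
  have h2 := congrArg TrivSqZeroExt.snd h
  simp only [hin, ← inl_mul] at h2
  rw [← inl_sum] at h2
  simpa using h2.symm

theorem injective_gradientMap [Algebra k L] (f : MvPolynomial (Fin 4) k) (hf : f.IsHomogeneous 3)
    (S : Gr42 L) (h0 : sigma f hf S = 0) (hS : IsSmoothAlong f S)
    {p : (Fin 4 → L) →ₗ[L] S.toSubmodule} {j : ((Fin 4 → L) ⧸ S.toSubmodule) →ₗ[L] (Fin 4 → L)}
    (hpj : ∀ v, (p v : Fin 4 → L) + j (S.toSubmodule.mkQ v) = v)
    (hp : ∀ s : S.toSubmodule, p s = s) : Function.Injective (gradientMap f hf S j) := by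
  rw [← LinearMap.ker_eq_bot, LinearMap.ker_eq_bot']
  intro θ hθ
  have hf0 : restrict f S = 0 := congrArg Subtype.val h0
  let K := AlgebraicClosure L
  let s : Basis (Fin 2) L S.toSubmodule := finBasisOfFinrankEq L _ (finrank_toSubmodule S)
  let q : Basis (Fin 2) L ((Fin 4 → L) ⧸ S.toSubmodule) :=
    finBasisOfFinrankEq L _ (finrank_quotient S)
  let A : Fin 2 → Fin 2 → L := fun m n => q.repr (θ (s m)) n
  have hA : ∀ m, θ (s m) = A m 0 • q 0 + A m 1 • q 1 := fun m => by
    rw [← Fin.sum_univ_two fun n => A m n • q n, q.sum_repr]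
  -- `z n` is the derivative of `f` in the normal direction `j (q n)`, restricted to `S`: a binary
  -- quadratic form.
  let z : Fin 2 → SymmetricAlgebra L (Dual L S.toSubmodule) := fun n =>
    ∑ i, j (q n) i • restrict (pderiv i f) S
  have hz : ∀ n, z n ∈ LinearMap.range (SymmetricAlgebra.ι L (Dual L S.toSubmodule)) ^ 2 :=
    fun n => Submodule.sum_mem _ fun i _ => Submodule.smul_mem _ _ (restrict_mem_pow hf.pderiv S)
  obtain ⟨p₀, p₁, p₂, hpq⟩ := exists_lineEval_eq_quadratic S (s 0) (s 1) K (hz 0)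
  obtain ⟨r₀, r₁, r₂, hrq⟩ := exists_lineEval_eq_quadratic S (s 0) (s 1) K (hz 1)
  -- The equation `gradientMap θ = 0` evaluated at `x s₀ + y s₁`; the rows of `A` are the
  -- coordinates of `θ (s m)`, so its columns give the two linear forms.
  have hsyz : ∀ x y : K, (A 0 0 • x + A 1 0 • y) * (p₀ * x ^ 2 + p₁ * (x * y) + p₂ * y ^ 2) +
      (A 0 1 • x + A 1 1 • y) * (r₀ * x ^ 2 + r₁ * (x * y) + r₂ * y ^ 2) = 0 := by
    intro x y
    have h : lineEval S (s 0) (s 1) x y (∑ i : Fin 4, restrict (pderiv i f) S *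
        SymmetricAlgebra.ι L _ (LinearMap.proj i ∘ₗ j ∘ₗ θ)) = 0 := by
      have := congrArg Subtype.val hθ
      exact (congrArg _ this).trans (map_zero _)
    rw [← h, ← hpq, ← hrq, map_sum, map_sum, map_sum, Finset.mul_sum, Finset.mul_sum,
      ← Finset.sum_add_distrib]
    refine Finset.sum_congr rfl fun i _ => ?_
    rw [map_mul, map_smul, map_smul, lineEval_ι]
    simp only [LinearMap.comp_apply, hA, map_add, map_smul, LinearMap.proj_apply, smul_eq_mul]
    simp only [Algebra.smul_def, map_add, map_mul]
    ring
  obtain ⟨c₀, c₁, c₂, c₃⟩ := eq_zero_of_binaryCubic_eq_zero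
    (c₀ := A 0 0 • p₀ + A 0 1 • r₀)
    (c₁ := A 0 0 • p₁ + A 1 0 • p₀ + A 0 1 • r₁ + A 1 1 • r₀)
    (c₂ := A 0 0 • p₂ + A 1 0 • p₁ + A 0 1 • r₂ + A 1 1 • r₁)
    (c₃ := A 1 0 • p₂ + A 1 1 • r₂) (fun x y => by
      rw [← hsyz x y]
      simp only [Algebra.smul_def]
      ring)
  by_contra hne
  simp only [Algebra.smul_def] at c₀ c₁ c₂ c₃
  obtain ⟨x, y, hxy, hpz, hrz⟩ := IsAlgClosed.exists_common_zero_of_linear_syzygy (K := K)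
    (by
      rintro ⟨a, b, c, d⟩
      rw [map_eq_zero] at a b c d
      refine hne (s.ext fun m => ?_)
      fin_cases m
      · simpa [a, c] using hA 0
      · simpa [b, d] using hA 1) c₀ c₁ c₂ c₃
  let v : Fin 4 → K := fun i => (s 0).1 i • x + (s 1).1 i • y
  have hev : ∀ g : MvPolynomial (Fin 4) k, aeval v g = lineEval S (s 0) (s 1) x y (restrict g S) :=
    fun g => by
      rw [lineEval_restrict, aeval_def, IsScalarTower.algebraMap_eq k L K]
  refine hS v ?_ ?_ ⟨?_, fun i => ?_⟩
  · have hv : v = x • (fun i => algebraMap L K ((s 0).1 i)) +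
        y • fun i => algebraMap L K ((s 1).1 i) := by
      funext i
      change (s 0).1 i • x + (s 1).1 i • y = x * _ + y * _
      rw [Algebra.smul_def, Algebra.smul_def, mul_comm, mul_comm y]
    rw [hv]
    exact add_mem (Submodule.smul_mem _ _ (Submodule.subset_span ⟨_, (s 0).2, rfl⟩))
      (Submodule.smul_mem _ _ (Submodule.subset_span ⟨_, (s 1).2, rfl⟩))
  · intro hv
    -- Every `L`-linear form on `L^4`, extended to `K`, kills `v = 0`; the coordinate forms of `S`
    -- composed with `p` recover `x` and `y`.
    have hc : ∀ c : (Fin 4 → L) →ₗ[L] L, c (s 0) • x + c (s 1) • y = 0 := fun c => by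
      rw [LinearMap.pi_apply_eq_sum_univ c, LinearMap.pi_apply_eq_sum_univ c, Finset.sum_smul,
        Finset.sum_smul, ← Finset.sum_add_distrib]
      refine Finset.sum_eq_zero fun i _ => ?_
      have hvi : (s 0).1 i • x + (s 1).1 i • y = 0 := congrFun hv i
      rw [smul_eq_mul, smul_eq_mul, mul_comm, mul_comm ((s 1).1 i), mul_smul, mul_smul, ← smul_add,
        hvi, smul_zero]
    have hx := hc (s.coord 0 ∘ₗ p)
    have hy := hc (s.coord 1 ∘ₗ p)
    simp [hp] at hx hy
    simp [hx, hy] at hxy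
  · rw [hev, hf0, map_zero]
  -- `Λ` is the gradient of `f` at `v` as a linear form. It vanishes on `S` since `f|S = 0` and on
  -- the image of `j` by the choice of `(x, y)`, hence on all of `L^4`.
  · let Λ : (Fin 4 → L) →ₗ[L] K := Fintype.linearCombination L fun i => aeval v (pderiv i f)
    have hΛ : ∀ u, Λ u = ∑ i, u i • aeval v (pderiv i f) := fun u => rfl
    have hΛs : Λ ∘ₗ S.toSubmodule.subtype = 0 := by
      refine s.ext fun m => ?_
      have hd := sum_smul_pderiv_eq_zero hf0 (s 0) (s 1) x y
      have hd' : ∀ c d : K, ∑ i, aeval v (pderiv i f) *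
          ((s 0).1 i • c + (s 1).1 i • d) = 0 := fun c d => by
        rw [← hd c d]
        refine Finset.sum_congr rfl fun i _ => ?_
        rw [hev, lineEval_restrict]
      fin_cases m
      · simpa [hΛ, Algebra.smul_def, mul_comm] using hd' 1 0
      · simpa [hΛ, Algebra.smul_def, mul_comm] using hd' 0 1
    have hΛz : ∀ n, Λ (j (q n)) = lineEval S (s 0) (s 1) x y (z n) := fun n => by
      simp [hΛ, hev, z]
    have hΛj : Λ ∘ₗ j = 0 := by
      refine q.ext fun n => ?_
      fin_cases n
      · exact (hΛz 0).trans ((hpq x y).trans hpz)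
      · exact (hΛz 1).trans ((hrq x y).trans hrz)
    have hΛ0 : ∀ u, Λ u = 0 := fun u => by
      rw [← hpj u, map_add]
      have e1 := LinearMap.congr_fun hΛs (p u)
      have e2 := LinearMap.congr_fun hΛj (S.toSubmodule.mkQ u)
      simp only [LinearMap.comp_apply, LinearMap.zero_apply, Submodule.subtype_apply] at e1 e2
      rw [e1, e2, add_zero]
    have h1 := hΛ0 (Pi.single i 1)
    rw [hΛ, Finset.sum_eq_single i] at h1
    · simpa using h1
    · intro b _ hb
      simp [hb]
    · simp

/-! ### The criterion and its two geometric hypotheses. -/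

theorem isSimpleZero_of_isSmoothAlong [Algebra k L] (f : MvPolynomial (Fin 4) k)
    (hf : f.IsHomogeneous 3) (S : Gr42 L) (h0 : sigma f hf S = 0) (hS : IsSmoothAlong f S) :
    IsSimpleZero f hf S := by
  obtain ⟨p, hp⟩ := LinearMap.exists_leftInverse_of_injective S.toSubmodule.subtype
    S.toSubmodule.ker_subtype
  have hp' : ∀ s : S.toSubmodule, p s = s := fun s => LinearMap.congr_fun hp s
  -- The projection `1 - p` onto the complement `ker p` kills `S`, so it descends to the quotient.
  let j : ((Fin 4 → L) ⧸ S.toSubmodule) →ₗ[L] (Fin 4 → L) :=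
    S.toSubmodule.liftQ (LinearMap.id - S.toSubmodule.subtype ∘ₗ p) fun s hs => by
      simp [hp' ⟨s, hs⟩]
  have hpj : ∀ v, (p v : Fin 4 → L) + j (S.toSubmodule.mkQ v) = v := fun v => by simp [j]
  exact ⟨h0, gradientMap f hf S j, isDifferential_gradientMap f hf S h0 hpj hp',
    bijective_of_injective (injective_gradientMap f hf S h0 hS hpj hp')⟩

/-- Restriction to `S` is a ring homomorphism that kills the linear forms generating the ideal of
the line. -/
theorem sigma_eq_zero_of_lineOn [Algebra k L] {f : MvPolynomial (Fin 4) k}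
    (hf : f.IsHomogeneous 3) {S : Gr42 L} (hS : LineOn S f) : sigma f hf S = 0 := by
  refine Subtype.ext ?_
  change restrict f S = 0
  let Φ : MvPolynomial (Fin 4) L →+* SymmetricAlgebra L (Dual L S.toSubmodule) :=
    eval₂Hom (algebraMap L _) fun i => SymmetricAlgebra.ι L _ (coord S i)
  have hker : lineIdeal S ≤ RingHom.ker Φ := by
    refine Ideal.span_le.2 ?_
    rintro _ ⟨c, hc, rfl⟩
    have hcoord : ∑ i, c i • coord S i = 0 := LinearMap.ext fun s => by
      simpa [coord] using hc s s.2
    have h : Φ (∑ i, C (c i) * X i) = SymmetricAlgebra.ι L _ (∑ i, c i • coord S i) := by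
      simp [Φ, Algebra.smul_def]
    rw [SetLike.mem_coe, RingHom.mem_ker, h, hcoord, map_zero]
  have h := RingHom.mem_ker.1 (hker hS)
  rw [coe_eval₂Hom, eval₂_map] at h
  exact h

/-- Over the algebraic closure of `k`, `f` and its partials have at most the origin as common zero.
By the Nullstellensatz a power of each `x_i` lies in the ideal they generate over `k`, and this
membership forces `v = 0` over any extension field. -/
theorem not_singularAt_of_isSmoothSurface {f : MvPolynomial (Fin 4) k} (hf : IsSmoothSurface f)
    {K : Type*} [Field K] [Algebra k K] {v : Fin 4 → K} (hv : v ≠ 0) : ¬ SingularAt f v := by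
  rintro ⟨h, h'⟩
  let I : Ideal (MvPolynomial (Fin 4) k) := Ideal.span (insert f (Set.range fun i => pderiv i f))
  have hI : ∀ g ∈ I, aeval v g = 0 := by
    have : I ≤ RingHom.ker (aeval v : MvPolynomial (Fin 4) k →ₐ[k] K) := by
      refine Ideal.span_le.2 (Set.insert_subset h ?_)
      rintro _ ⟨i, rfl⟩
      exact h' i
    exact fun g hg => this hg
  refine hv (funext fun i => ?_)
  have hX : X i ∈ I.radical := by
    rw [← vanishingIdeal_zeroLocus_eq_radical (K := AlgebraicClosure k)]
    intro w hw
    have hw' : ∀ g ∈ insert f (Set.range fun i => pderiv i f), aeval w g = 0 :=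
      fun g hg => hw g (Ideal.subset_span hg)
    have : w = 0 := by
      by_contra hne
      exact hf w hne ⟨hw' f (Set.mem_insert _ _), fun i => hw' _ (Set.mem_insert_of_mem _ ⟨i, rfl⟩)⟩
    simp [this]
  obtain ⟨n, hn⟩ := hX
  have := hI _ hn
  rw [map_pow, aeval_X] at this
  exact eq_zero_of_pow_eq_zero this

end CubicLines

theorem mainTheorem7 {k : Type*} [Field k] (f : MvPolynomial (Fin 4) k)
    (hf : f.IsHomogeneous 3) :
    (CubicLines.IsSmoothSurface f →
      ∀ (L : Type*) [Field L] [Algebra k L] (S : Gr42 L),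
        CubicLines.sigma f hf S = 0 → CubicLines.IsSimpleZero f hf S) ∧
    (∀ (L : Type*) [Field L] [Algebra k L] (S : Gr42 L),
      CubicLines.LineOn S f → CubicLines.IsSmoothAlong f S →
        CubicLines.IsSimpleZero f hf S) :=
  ⟨fun h _ _ _ S h0 => CubicLines.isSimpleZero_of_isSmoothAlong f hf S h0 fun _ _ hv =>
      CubicLines.not_singularAt_of_isSmoothSurface h hv,
    fun _ _ _ S hS h => CubicLines.isSimpleZero_of_isSmoothAlong f hf S
      (CubicLines.sigma_eq_zero_of_lineOn hf hS) h⟩
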